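/- Let $K\ge 1$ and let $0<r_1<\dots<r_K$ be rates. Time is slotted. In each slot $t=1,2,\dots$ a vector of outcomes $(Y_1(t),\dots,Y_K(t))\in\{0,1\}^K$ is drawn, independently and identically distributed over slots, with $\mathbb{P}(Y_k(t)=1)=\theta_k$ and, almost surely, $Y_k(t)\ge Y_l(t)$ whenever $k<l$ (a transmission that succeeds at some rate also succeeds at every lower rate). A rate selection algorithm $\pi$ (possibly randomized) selects in each slot an index $k^\pi(t)$ as a function of the previously selected indices, their observed outcomes and independent internal randomization; it then observes only $Y_{k^\pi(t)}(t)$ and receives the reward $r_{k^\pi(t)}Y_{k^\pi(t)}(t)$. The parameter $\theta=(\theta_1,\dots,\theta_K)$ is unknown to the algorithm and belongs to $\mathcal{T}\cap\mathcal{U}$, where $$\mathcal{T}=\{\eta\in[0,1]^K:\ \eta_1\ge\dots\ge\eta_K\},$$ $$\mathcal{U}=\{\eta\in[0,1]^K:\ \exists j,\ r_1\eta_1<\dots<r_j\eta_j \text{ and } r_j\eta_j>r_{j+1}\eta_{j+1}>\dots>r_K\eta_K\}.$$ For $\theta\in\mathcal{T}\cap\mathcal{U}$ let $k^\star=k^\star(\theta)$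 be the unique maximizer of $k\mapsto r_k\theta_k$, let $t_k^\pi(T)$ be the number of slots among the first $T$ in which $\pi$ selects $k$, and define the regret $$R^\pi(T)=r_{k^\star}\theta_{k^\star}T-\sum_{k=1}^K r_k\theta_k\,\mathbb{E}_\theta[t_k^\pi(T)].$$ The algorithm $\pi$ is called uniformly good if, for every parameter in $\mathcal{T}\cap\mathcal{U}$, every $k\ne k^\star$ and every $\alpha>0$, $\mathbb{E}[t_k^\pi(T)]=o(T^\alpha)$ as $T\to\infty$. For $p,q\in[0,1]$ let $I(p,q)=p\log\frac pq+(1-p)\log\frac{1-p}{1-q}\in[0,\infty]$ be the Kullback-Leibler divergence between the Bernoulli distributions with means $p$ and $q$ (with $0\log 0=0$, and $I(p,q)=\infty$ if $q=0\ne p$ or $q=1\ne p$). Let $N(k^\star)=\{l\in\{k^\star-1,k^\star+1\}\cap\{1,\dots,K\}:\ r_{k^\star}\theta_{k^\star}\le r_l\}$ and $$c(\theta)=\sum_{k\in N(k^\star)}\frac{r_{k^\star}\theta_{k^\star}-r_k\theta_k}{I\left(\theta_k,\ r_{k^\star}\theta_{k^\star}/r_k\right)},$$ where a summand with infinite denominator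 is $0$. Theorem. If $\pi$ is uniformly good, then for every $\theta\in\mathcal{T}\cap\mathcal{U}$, $$\liminf_{T\to\infty}\frac{R^\pi(T)}{\log T}\ \ge\ c(\theta),$$ and the sum defining $c(\theta)$ has at most two terms, whatever the number $K$ of rates. -/

import Mathlib

open Filter Asymptotics
open scoped ENNReal

namespace RateSelection

/-! ### Parameters -/

/-- The set `𝒯` of success probability vectors that do not increase with the rate. -/
def correlatedParams (K : ℕ) : Set (Fin K → ℝ) :=
  {η | (∀ k, η k ∈ Set.Icc (0 : ℝ) 1) ∧ Antitone η}

/-- The set `𝒰` of success probability vectors for which the throughput `k ↦ r k * η k` is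
strictly unimodal: strictly increasing up to some index, strictly decreasing from it on. -/
def unimodalParams {K : ℕ} (r : Fin K → ℝ) : Set (Fin K → ℝ) :=
  {η | (∀ k, η k ∈ Set.Icc (0 : ℝ) 1) ∧ ∃ kstar : Fin K,
    StrictMonoOn (fun k => r k * η k) (Set.Iic kstar) ∧
    StrictAntiOn (fun k => r k * η k) (Set.Ici kstar)}

/-- `k` is the index of an optimal rate: it maximizes the throughput `r l * θ l`. -/
def IsOptimal {K : ℕ} (r θ : Fin K → ℝ) (k : Fin K) : Prop :=
  ∀ l, r l * θ l ≤ r k * θ k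

/-! ### The channel and the interaction -/

/-- `ν` is the law of the vector of outcomes (`true` for success) that the `K` rates would have
in one slot. Outcomes are correlated: if a transmission at some rate succeeds, then it also
succeeds at every lower rate (equivalently, if it fails, it also fails at every higher rate).
The outcome at rate `k` is Bernoulli with mean `θ k`. -/
structure IsChannel {K : ℕ} (θ : Fin K → ℝ) (ν : PMF (Fin K → Bool)) : Prop where
  correlated : ∀ x ∈ ν.support, ∀ k l : Fin K, k < l → x l = true → x k = true
  mean : ∀ k, (ν.map fun x => x k) true = ENNReal.ofReal (θ k)

/-- What has been observed in the first `t` slots: in each of them, the selected rate and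
whether the transmission at that rate was successful. -/
abbrev History (K t : ℕ) : Type := Fin t → Fin K × Bool

/-- A (possibly randomized) sequential rate selection algorithm: given the observations of the
first `t` slots, the law of the rate selected in the next slot. -/
abbrev Policy (K : ℕ) : Type := (t : ℕ) → History K t → PMF (Fin K)

/-- The law of the history of the first `t` slots under algorithm `π`. In every slot the rate is
drawn from `π` given the past, the outcome vector is drawn from `ν` independently of everything
else, and only the outcome at the selected rate is observed. -/
noncomputable def historyLaw {K : ℕ} (π : Policy K) (ν : PMF (Fin K → Bool)) :
    (t : ℕ) → PMF (History K t)
  | 0 => PMF.pure Fin.elim0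
  | t + 1 =>
      (historyLaw π ν t).bind fun h =>
        (π t h).bind fun k =>
          ν.bind fun x => PMF.pure (Fin.snoc (α := fun _ => Fin K × Bool) h (k, x k))

/-- The number of slots of the history `h` in which rate `k` was selected. -/
def selectionCount {K T : ℕ} (k : Fin K) (h : History K T) : ℕ :=
  (Finset.univ.filter fun s => (h s).1 = k).card

/-- `𝔼[t_k(T)]`, the expected number of selections of rate `k` in the first `T` slots. -/
noncomputable def expectedCount {K : ℕ} (π : Policy K) (ν : PMF (Fin K → Bool))
    (k : Fin K) (T : ℕ) : ℝ :=
  ∑ h : History K T, (historyLaw π ν T h).toReal * (selectionCount k h : ℝ)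

/-- The regret `R(T) = r_{k⋆} θ_{k⋆} T - ∑ k, θ_k r_k 𝔼[t_k(T)]`. -/
noncomputable def regret {K : ℕ} (r θ : Fin K → ℝ) (kstar : Fin K) (π : Policy K)
    (ν : PMF (Fin K → Bool)) (T : ℕ) : ℝ :=
  θ kstar * r kstar * T - ∑ k, θ k * r k * expectedCount π ν k T

/-- Uniformly good algorithms for the structured problem with rates `r`: for all parameters in
`𝒯 ∩ 𝒰`, every suboptimal rate is selected `o(T ^ α)` times in expectation, for all `α > 0`. -/
def UniformlyGood {K : ℕ} (r : Fin K → ℝ) (π : Policy K) : Prop :=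
  ∀ θ ∈ correlatedParams K ∩ unimodalParams r, ∀ ν : PMF (Fin K → Bool), IsChannel θ ν →
    ∀ kstar, IsOptimal r θ kstar → ∀ α : ℝ, 0 < α → ∀ k, k ≠ kstar →
      (fun T : ℕ => expectedCount π ν k T) =o[atTop] fun T : ℕ => (T : ℝ) ^ α

/-! ### The constant of the lower bound -/

/-- The Kullback-Leibler divergence between the Bernoulli distributions with means `p` and `q`
in `[0, 1]`, with its usual value `∞` when the first is not absolutely continuous with respect
to the second (and `0 log 0 = 0`). -/
noncomputable def bernoulliKL (p q : ℝ) : ℝ≥0∞ :=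
  open Classical in
  if (q = 0 ∧ p ≠ 0) ∨ (q = 1 ∧ p ≠ 1) then ⊤
  else ENNReal.ofReal (p * Real.log (p / q) + (1 - p) * Real.log ((1 - p) / (1 - q)))

/-- `N(k) = {l ∈ {k - 1, k + 1} : r_k θ_k ≤ r_l}`. -/
noncomputable def neighbours {K : ℕ} (r θ : Fin K → ℝ) (k : Fin K) : Finset (Fin K) :=
  open Classical in
  Finset.univ.filter fun l =>
    ((l : ℕ) + 1 = (k : ℕ) ∨ (l : ℕ) = (k : ℕ) + 1) ∧ r k * θ k ≤ r l

/-- `c(θ) = ∑_{k ∈ N(k⋆)} (r_{k⋆} θ_{k⋆} - r_k θ_k) / I(θ_k, r_{k⋆} θ_{k⋆} / r_k)`; a summand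
whose divergence is infinite is zero. -/
noncomputable def lowerConst {K : ℕ} (r θ : Fin K → ℝ) (kstar : Fin K) : ℝ≥0∞ :=
  ∑ k ∈ neighbours r θ kstar,
    ENNReal.ofReal (r kstar * θ kstar - r k * θ k) /
      bernoulliKL (θ k) (r kstar * θ kstar / r k)

end RateSelection

/-! A uniformly good algorithm must be able to rule out parameters under which a rate other than k⋆
is best. For a neighbour k of k⋆ with q₀ = r_{k⋆} θ_{k⋆} / r_k < 1, fix q slightly above q₀ and
`raise` to q every smaller success probability at the rates up to k. The result is still monotone
and unimodal, and its optimum is k. The fraction of slots spent at k⋆ is close to 1 under θ but at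
most T^(δ-1) under the raised parameter. By a change of measure (`mul_historyExp_sub_log_two_le`)
the expected log-likelihood ratio is then at least about log T (`eventually_log_le_information`).

Only rates on the same side of k⋆ as k carry this information. Selecting one of them yields at most
I(θ_k, q) and costs at least the gap of k, so that side incurs regret of at least about gap / I(θ_k,
q) · log T (`gap_mul_information_le`). Choosing q close to q₀ gives the summand of k. The two sides
are disjoint, so the summands of both neighbours add up (`sum_sideRegret_le_regret`). -/

namespace RateSelection

/-! ### The divergence between Bernoulli distributions, as a real number -/

/-- The divergence between Bernoulli distributions, with junk values where it is infinite. -/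
noncomputable def realKL (p q : ℝ) : ℝ :=
  p * Real.log (p / q) + (1 - p) * Real.log ((1 - p) / (1 - q))

theorem realKL_self (p : ℝ) : realKL p p = 0 := by
  unfold realKL
  have h : ∀ x : ℝ, x * Real.log (x / x) = 0 := fun x => by
    rcases eq_or_ne x 0 with rfl | hx
    · simp
    · simp [div_self hx]
  rw [h, h, add_zero]

theorem sub_le_mul_log_div {x y : ℝ} (hx : 0 ≤ x) (hy : 0 < y) :
    x - y ≤ x * Real.log (x / y) := by
  rcases hx.eq_or_lt with rfl | hx
  · simp [hy.le]
  · have h := Real.log_le_sub_one_of_pos (div_pos hy hx)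
    have h2 : Real.log (x / y) = -Real.log (y / x) := by rw [← Real.log_inv, inv_div]
    have h3 : x * Real.log (y / x) ≤ x * (y / x - 1) := mul_le_mul_of_nonneg_left h hx.le
    have h4 : x * (y / x - 1) = y - x := by field_simp
    rw [h2]
    linarith

theorem sub_lt_mul_log_div {x y : ℝ} (hx : 0 < x) (hy : 0 < y) (hxy : x ≠ y) :
    x - y < x * Real.log (x / y) := by
  have h := Real.log_lt_sub_one_of_pos (div_pos hy hx)
    (fun h => hxy ((div_eq_one_iff_eq hx.ne').1 h).symm)
  have h2 : Real.log (x / y) = -Real.log (y / x) := by rw [← Real.log_inv, inv_div]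
  have h3 : x * Real.log (y / x) < x * (y / x - 1) := mul_lt_mul_of_pos_left h hx
  have h4 : x * (y / x - 1) = y - x := by field_simp
  rw [h2]
  linarith

theorem realKL_nonneg {p q : ℝ} (hp : 0 ≤ p) (hp1 : p ≤ 1) (hq : 0 < q) (hq1 : q < 1) :
    0 ≤ realKL p q := by
  have h1 := sub_le_mul_log_div hp hq
  have h2 := sub_le_mul_log_div (sub_nonneg.2 hp1) (sub_pos.2 hq1)
  unfold realKL
  linarith

theorem realKL_pos {p q : ℝ} (hp : 0 ≤ p) (hpq : p < q) (hq1 : q < 1) : 0 < realKL p q := by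
  have h1 := sub_le_mul_log_div hp (hp.trans_lt hpq)
  have h2 := sub_lt_mul_log_div (x := 1 - p) (y := 1 - q) (by linarith) (by linarith)
    (by intro h; linarith)
  unfold realKL
  linarith

/-- Three-point identity: I(p, q) - I(p', q) is I(p, p') plus (p' - p) times log((1 - p') / (1 - q))
- log(p' / q), and both parts are nonnegative when p ≤ p' ≤ q. -/
theorem realKL_anti_left {p p' q : ℝ} (hp : 0 ≤ p) (hpp : p ≤ p') (hpq : p' ≤ q) (hq : 0 < q)
    (hq1 : q < 1) : realKL p' q ≤ realKL p q := by
  rcases (hp.trans hpp).eq_or_lt with h0 | hp'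
  · rw [le_antisymm hpp (h0 ▸ hp)]
  have hp1 : p' < 1 := hpq.trans_lt hq1
  have e1 : p * Real.log (p / q) = p * Real.log (p / p') + p * Real.log (p' / q) := by
    rcases hp.eq_or_lt with rfl | hp0
    · simp
    · rw [← mul_add, ← Real.log_mul (by positivity) (by positivity)]
      congr 2
      field_simp
  have e2 : (1 - p) * Real.log ((1 - p) / (1 - q)) = (1 - p) * Real.log ((1 - p) / (1 - p')) +
      (1 - p) * Real.log ((1 - p') / (1 - q)) := by
    have a1 : 0 < 1 - p := by linarith
    have a2 : 0 < 1 - p' := by linarith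
    have a3 : 0 < 1 - q := by linarith
    rw [← mul_add, ← Real.log_mul (by positivity) (by positivity)]
    congr 2
    field_simp
  have h1 := realKL_nonneg hp (hpp.trans hp1.le) hp' hp1
  have l1 : Real.log (p' / q) ≤ 0 := Real.log_nonpos (by positivity) ((div_le_one hq).2 hpq)
  have l2 : 0 ≤ Real.log ((1 - p') / (1 - q)) :=
    Real.log_nonneg ((one_le_div (by linarith)).2 (by linarith))
  have l3 : 0 ≤ (p' - p) * (Real.log ((1 - p') / (1 - q)) - Real.log (p' / q)) :=
    mul_nonneg (by linarith) (by linarith)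
  unfold realKL at h1 ⊢
  rw [e1, e2]
  linarith

theorem continuousAt_realKL {p q : ℝ} (hq : 0 < q) (hq1 : q < 1) :
    ContinuousAt (realKL p) q := by
  have hq' : 1 - q ≠ 0 := by linarith
  have h : ∀ x y : ℝ, y ≠ 0 → ContinuousAt (fun y => x * Real.log (x / y)) y := fun x y hy => by
    rcases eq_or_ne x 0 with rfl | hx
    · simpa using continuousAt_const
    · exact continuousAt_const.mul ((continuousAt_const.div continuousAt_id hy).log
        (div_ne_zero hx hy))
  exact (h p q hq.ne').add
    ((h (1 - p) (1 - q) hq').comp (f := fun y : ℝ => 1 - y) (by fun_prop))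

/-! ### Channels -/

/-- The probability of the outcome `y` under a Bernoulli distribution with mean `p`. -/
def bernoulliMass (p : ℝ) (y : Bool) : ℝ := if y then p else 1 - p

theorem sum_bernoulliMass (p : ℝ) : ∑ y, bernoulliMass p y = 1 := by
  simp [bernoulliMass]

theorem bernoulliMass_nonneg {p : ℝ} (hp : p ∈ Set.Icc (0 : ℝ) 1) (y : Bool) :
    0 ≤ bernoulliMass p y := by
  cases y <;> simp [bernoulliMass, hp.1, hp.2]

theorem IsChannel.toReal_map {K : ℕ} {θ : Fin K → ℝ} {ν : PMF (Fin K → Bool)}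
    (hν : IsChannel θ ν) {k : Fin K} (hk : 0 ≤ θ k) (y : Bool) :
    ((ν.map fun x => x k) y).toReal = bernoulliMass (θ k) y := by
  have ht : ((ν.map fun x => x k) true).toReal = θ k := by
    rw [hν.mean, ENNReal.toReal_ofReal hk]
  have hs : ((ν.map fun x => x k) true).toReal + ((ν.map fun x => x k) false).toReal = 1 := by
    rw [← ENNReal.toReal_add (PMF.apply_ne_top _ _) (PMF.apply_ne_top _ _)]
    have := (ν.map fun x => x k).tsum_coe
    rw [tsum_fintype, Fintype.sum_bool] at this
    rw [this, ENNReal.toReal_one]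
  cases y
  · simp only [bernoulliMass, Bool.false_eq_true, if_false]; linarith
  · simpa [bernoulliMass] using ht

/-- Every vector of nonincreasing success probabilities is the mean of a channel. -/
theorem exists_isChannel {K : ℕ} {θ : Fin K → ℝ} (hθ : θ ∈ correlatedParams K) :
    ∃ ν : PMF (Fin K → Bool), IsChannel θ ν := by
  classical
  obtain ⟨h01, hanti⟩ := hθ
  -- Monotone coupling: a single uniform `u` on (0, 1] decides all rates, so success at one rate
  -- implies success wherever θ is larger.
  let X : ℝ → Fin K → Bool := fun u k => decide (u ≤ θ k)
  have hX : Measurable X := by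
    refine measurable_pi_lambda _ fun k => ?_
    refine measurable_to_bool ?_
    convert measurableSet_Iic (a := θ k) using 1
    ext u
    simp [X]
  let μ : MeasureTheory.Measure ℝ := MeasureTheory.volume.restrict (Set.Ioc 0 1)
  have : MeasureTheory.IsProbabilityMeasure μ := ⟨by simp [μ]⟩
  have : MeasureTheory.IsProbabilityMeasure (μ.map X) :=
    MeasureTheory.Measure.isProbabilityMeasure_map hX.aemeasurable
  refine ⟨(μ.map X).toPMF, ?_, fun k => ?_⟩
  · intro x hx k l hkl hl
    rw [PMF.mem_support_iff, MeasureTheory.Measure.toPMF_apply,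
      MeasureTheory.Measure.map_apply hX (MeasurableSet.singleton x)] at hx
    obtain ⟨u, hu⟩ := MeasureTheory.nonempty_of_measure_ne_zero hx
    have hu : X u = x := hu
    rw [← hu] at hl ⊢
    simp only [X, decide_eq_true_eq] at hl ⊢
    exact hl.trans (hanti hkl.le)
  · have h1 : ((μ.map X).toPMF.map fun x => x k) true =
        (μ.map X).toPMF.toMeasure ((fun x : Fin K → Bool => x k) ⁻¹' {true}) := by
      rw [← PMF.toMeasure_map_apply _ _ _ (measurable_pi_apply k) (MeasurableSet.singleton _),
        PMF.toMeasure_apply_singleton _ _ (MeasurableSet.singleton _)]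
    rw [h1, MeasureTheory.Measure.toPMF_toMeasure,
      MeasureTheory.Measure.map_apply hX (measurable_pi_apply k (MeasurableSet.singleton _))]
    have h2 : X ⁻¹' ((fun x : Fin K → Bool => x k) ⁻¹' {true}) = Set.Iic (θ k) := by
      ext u; simp [X]
    rw [h2, MeasureTheory.Measure.restrict_apply measurableSet_Iic, Set.inter_comm,
      Set.Ioc_inter_Iic, min_eq_right (h01 k).2, Real.volume_Ioc, sub_zero]

/-! ### Expectations over histories -/

/-- The expectation of a function of the history of the first `t` slots. -/
noncomputable def historyExp {K : ℕ} (π : Policy K) (ν : PMF (Fin K → Bool)) (t : ℕ)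
    (g : History K t → ℝ) : ℝ :=
  ∑ h, (historyLaw π ν t h).toReal * g h

/-- The history `h` followed by one more slot. -/
abbrev History.snoc {K t : ℕ} (h : History K t) (a : Fin K × Bool) : History K (t + 1) :=
  Fin.snoc (α := fun _ => Fin K × Bool) h a

section HistoryExp

variable {K : ℕ} {π : Policy K} {ν : PMF (Fin K → Bool)} {t : ℕ}

theorem sum_history_succ (g : History K (t + 1) → ℝ) :
    ∑ h, g h = ∑ h : History K t, ∑ k, ∑ y, g (h.snoc (k, y)) := by
  rw [← (Fin.snocEquiv fun _ => Fin K × Bool).sum_comp, Fintype.sum_prod_type_right]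
  refine Finset.sum_congr rfl fun h _ => ?_
  rw [Fintype.sum_prod_type]
  rfl

/-- Only the outcome at the selected rate is recorded, so the channel enters through its marginals
alone; the correlation between rates is invisible. -/
theorem historyLaw_succ_snoc (h : History K t) (k : Fin K) (y : Bool) :
    historyLaw π ν (t + 1) (h.snoc (k, y)) =
      historyLaw π ν t h * (π t h k * (ν.map fun x => x k) y) := by
  rw [historyLaw, PMF.bind_apply, tsum_eq_single h, PMF.bind_apply, tsum_eq_single k]
  · congr 2
    rw [PMF.map_apply, PMF.bind_apply]
    refine tsum_congr fun x => ?_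
    by_cases hx : y = x k
    · simp [PMF.pure_apply, hx]
    · rw [PMF.pure_apply, if_neg, if_neg hx, mul_zero]
      intro he
      exact hx (congrArg Prod.snd (Fin.snoc_injective2 he).2)
  · intro k' hk'
    rw [mul_eq_zero, PMF.bind_apply, ENNReal.tsum_eq_zero]
    refine Or.inr fun x => ?_
    rw [PMF.pure_apply, if_neg, mul_zero]
    intro he
    exact hk' (congrArg Prod.fst (Fin.snoc_injective2 he).2).symm
  · intro h' hh'
    rw [mul_eq_zero, PMF.bind_apply, ENNReal.tsum_eq_zero]
    refine Or.inr fun k' => ?_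
    rw [mul_eq_zero, PMF.bind_apply, ENNReal.tsum_eq_zero]
    refine Or.inr fun x => ?_
    rw [PMF.pure_apply, if_neg, mul_zero]
    intro he
    exact hh' (Fin.snoc_injective2 he).1.symm

theorem toReal_historyLaw_succ_snoc {θ : Fin K → ℝ} (hθ : ∀ k, 0 ≤ θ k) (hν : IsChannel θ ν)
    (h : History K t) (k : Fin K) (y : Bool) :
    (historyLaw π ν (t + 1) (h.snoc (k, y))).toReal =
      (historyLaw π ν t h).toReal * ((π t h k).toReal * bernoulliMass (θ k) y) := by
  rw [historyLaw_succ_snoc, ENNReal.toReal_mul, ENNReal.toReal_mul, hν.toReal_map (hθ k)]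

theorem sum_pmf_toReal {α : Type*} [Fintype α] (p : PMF α) : ∑ a, (p a).toReal = 1 := by
  rw [← ENNReal.toReal_sum fun a _ => p.apply_ne_top a, ← tsum_fintype (L := .unconditional _),
    p.tsum_coe, ENNReal.toReal_one]

theorem historyExp_const (c : ℝ) : historyExp π ν t (fun _ => c) = c := by
  rw [historyExp, ← Finset.sum_mul, sum_pmf_toReal, one_mul]

theorem historyExp_add (f g : History K t → ℝ) :
    historyExp π ν t (fun h => f h + g h) = historyExp π ν t f + historyExp π ν t g := by
  simp only [historyExp, mul_add, Finset.sum_add_distrib]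

theorem historyExp_const_mul (c : ℝ) (g : History K t → ℝ) :
    historyExp π ν t (fun h => c * g h) = c * historyExp π ν t g := by
  simp only [historyExp, Finset.mul_sum]
  exact Finset.sum_congr rfl fun h _ => by ring

theorem historyExp_mono {f g : History K t → ℝ} (hfg : ∀ h, f h ≤ g h) :
    historyExp π ν t f ≤ historyExp π ν t g :=
  Finset.sum_le_sum fun h _ => mul_le_mul_of_nonneg_left (hfg h) ENNReal.toReal_nonneg

theorem historyExp_succ {θ : Fin K → ℝ} (hθ : ∀ k, 0 ≤ θ k) (hν : IsChannel θ ν)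
    (g : History K (t + 1) → ℝ) :
    historyExp π ν (t + 1) g = historyExp π ν t fun h =>
      ∑ k, (π t h k).toReal * ∑ y, bernoulliMass (θ k) y * g (h.snoc (k, y)) := by
  rw [historyExp, sum_history_succ]
  refine Finset.sum_congr rfl fun h _ => ?_
  simp only [Finset.mul_sum, toReal_historyLaw_succ_snoc hθ hν]
  exact Finset.sum_congr rfl fun k _ => Finset.sum_congr rfl fun y _ => by ring

theorem selectionCount_snoc (l : Fin K) (h : History K t) (a : Fin K × Bool) :
    selectionCount l (h.snoc a) = selectionCount l h + if a.1 = l then 1 else 0 := by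
  rw [selectionCount, selectionCount, Finset.card_filter, Finset.card_filter,
    Fin.sum_univ_castSucc]
  simp only [History.snoc, Fin.snoc_castSucc, Fin.snoc_last]

theorem expectedCount_eq_historyExp (l : Fin K) :
    expectedCount π ν l t = historyExp π ν t fun h => (selectionCount l h : ℝ) := rfl

theorem expectedCount_nonneg (l : Fin K) : 0 ≤ expectedCount π ν l t :=
  Finset.sum_nonneg fun _ _ => by positivity

theorem sum_expectedCount : ∑ l, expectedCount π ν l t = t := by
  have h1 : ∀ h : History K t, ∑ l, (selectionCount l h : ℝ) = t := fun h => by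
    have := Finset.card_eq_sum_card_fiberwise (s := Finset.univ) (t := Finset.univ)
      (f := fun s => (h s).1) (fun _ _ => by simp)
    rw [Finset.card_univ, Fintype.card_fin] at this
    exact_mod_cast this.symm
  simp only [expectedCount]
  rw [Finset.sum_comm]
  simp only [← Finset.mul_sum, h1]
  exact historyExp_const _

theorem selectionCount_le (l : Fin K) (h : History K t) : selectionCount l h ≤ t := by
  simpa [selectionCount] using Finset.card_filter_le (Finset.univ : Finset (Fin t)) _

/-- Wald's identity: the expectation of a sum over slots of a function of the observations. -/
theorem historyExp_sum {θ : Fin K → ℝ} (hθ : ∀ k, 0 ≤ θ k) (hν : IsChannel θ ν)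
    (f : Fin K × Bool → ℝ) (t : ℕ) :
    historyExp π ν t (fun h => ∑ s, f (h s)) =
      ∑ l, (∑ y, bernoulliMass (θ l) y * f (l, y)) * expectedCount π ν l t := by
  induction t with
  | zero => simp [historyExp, expectedCount, selectionCount]
  | succ t ih =>
    -- One more slot adds the expected probability of selecting `l` there.
    have h1 : ∀ l, expectedCount π ν l (t + 1) =
        expectedCount π ν l t + historyExp π ν t fun h => (π t h l).toReal := fun l => by
      rw [expectedCount_eq_historyExp, historyExp_succ hθ hν, expectedCount_eq_historyExp,
        ← historyExp_add]
      congr 1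
      ext h
      push_cast [selectionCount_snoc]
      simp only [← Finset.sum_mul, sum_bernoulliMass, one_mul, mul_add, Finset.sum_add_distrib,
        sum_pmf_toReal]
      simp
    have h2 : historyExp π ν (t + 1) (fun h => ∑ s, f (h s)) =
        historyExp π ν t (fun h => ∑ s, f (h s)) +
          historyExp π ν t fun h => ∑ l, (π t h l).toReal *
            ∑ y, bernoulliMass (θ l) y * f (l, y) := by
      rw [historyExp_succ hθ hν, ← historyExp_add]
      congr 1
      ext h
      simp only [Fin.sum_univ_castSucc, History.snoc, Fin.snoc_castSucc, Fin.snoc_last, mul_add,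
        Finset.sum_add_distrib, ← Finset.sum_mul, sum_bernoulliMass, one_mul, sum_pmf_toReal]
    rw [h2, ih]
    simp only [h1, mul_add, Finset.sum_add_distrib]
    congr 1
    simp only [historyExp, Finset.mul_sum]
    rw [Finset.sum_comm]
    refine Finset.sum_congr rfl fun l _ => Finset.sum_congr rfl fun h _ => ?_
    rw [Finset.sum_mul]
    exact Finset.sum_congr rfl fun y _ => by ring

end HistoryExp

/-! ### Change of measure -/

/-- The log-likelihood ratio of one observation. -/
noncomputable def logLikelihood {K : ℕ} (θ θ' : Fin K → ℝ) (a : Fin K × Bool) : ℝ :=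
  Real.log (bernoulliMass (θ a.1) a.2 / bernoulliMass (θ' a.1) a.2)

section ChangeOfMeasure

variable {K : ℕ} {π : Policy K} {ν ν' : PMF (Fin K → Bool)} {θ θ' : Fin K → ℝ}

/-- The policy factors are common to both laws, and each observation contributes its likelihood
ratio. Equality can fail where an outcome is impossible under θ: the left side then vanishes,
whatever the junk value of the logarithm. -/
theorem historyLaw_mul_exp_le (hθ : ∀ k, θ k ∈ Set.Icc (0 : ℝ) 1)
    (hθ' : ∀ k, θ' k ∈ Set.Icc (0 : ℝ) 1) (hν : IsChannel θ ν) (hν' : IsChannel θ' ν')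
    (hac : ∀ k y, bernoulliMass (θ' k) y = 0 → bernoulliMass (θ k) y = 0)
    (t : ℕ) (h : History K t) :
    (historyLaw π ν t h).toReal * Real.exp (-∑ s, logLikelihood θ θ' (h s)) ≤
      (historyLaw π ν' t h).toReal := by
  induction t with
  | zero => simp [historyLaw]
  | succ t ih =>
    obtain ⟨h, ⟨k, y⟩, rfl⟩ : ∃ (h₀ : History K t) (a : Fin K × Bool), h = h₀.snoc a :=
      ⟨Fin.init h, h (Fin.last t), (Fin.snoc_init_self h).symm⟩
    rw [toReal_historyLaw_succ_snoc (fun k => (hθ k).1) hν,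
      toReal_historyLaw_succ_snoc (fun k => (hθ' k).1) hν']
    simp only [Fin.sum_univ_castSucc, History.snoc, Fin.snoc_castSucc, Fin.snoc_last]
    have h1 : bernoulliMass (θ k) y * Real.exp (-logLikelihood θ θ' (k, y)) ≤
        bernoulliMass (θ' k) y := by
      rcases (bernoulliMass_nonneg (hθ k) y).eq_or_lt with h0 | h0
      · rw [← h0, zero_mul]
        exact bernoulliMass_nonneg (hθ' k) y
      · have h0' : 0 < bernoulliMass (θ' k) y :=
          (bernoulliMass_nonneg (hθ' k) y).lt_of_ne fun e => h0.ne' (hac k y e.symm)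
        rw [logLikelihood, Real.exp_neg, Real.exp_log (div_pos h0 h0'), inv_div,
          mul_div_cancel₀ _ h0.ne']
    rw [neg_add, Real.exp_add]
    have hπ0 : 0 ≤ (π t h k).toReal := ENNReal.toReal_nonneg
    calc _ = ((historyLaw π ν t h).toReal * Real.exp (-∑ s, logLikelihood θ θ' (h s))) *
          ((π t h k).toReal *
            (bernoulliMass (θ k) y * Real.exp (-logLikelihood θ θ' (k, y)))) := by ring
      _ ≤ _ := mul_le_mul (ih h) (mul_le_mul_of_nonneg_left h1 hπ0)
          (mul_nonneg hπ0 (mul_nonneg (bernoulliMass_nonneg (hθ k) y) (Real.exp_nonneg _)))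
          ENNReal.toReal_nonneg

theorem sum_bernoulliMass_mul_logLikelihood (k : Fin K) :
    ∑ y, bernoulliMass (θ k) y * logLikelihood θ θ' (k, y) = realKL (θ k) (θ' k) := by
  simp [logLikelihood, bernoulliMass, realKL]

/-- The information gathered about `θ` against `θ'` bounds how differently `[0, 1]`-valued
functions of the history behave under the two parameters. -/
theorem mul_historyExp_sub_log_two_le (hθ : ∀ k, θ k ∈ Set.Icc (0 : ℝ) 1)
    (hθ' : ∀ k, θ' k ∈ Set.Icc (0 : ℝ) 1) (hν : IsChannel θ ν) (hν' : IsChannel θ' ν')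
    (hac : ∀ k y, bernoulliMass (θ' k) y = 0 → bernoulliMass (θ k) y = 0)
    {t : ℕ} (Z : History K t → ℝ) (hZ : ∀ h, Z h ∈ Set.Icc (0 : ℝ) 1) (a : ℝ)
    (ha : Real.exp a * historyExp π ν' t Z ≤ 1) :
    a * historyExp π ν t Z - Real.log 2 ≤
      ∑ l, realKL (θ l) (θ' l) * expectedCount π ν l t := by
  have hL := historyExp_sum (π := π) (fun k => (hθ k).1) hν (logLikelihood θ θ') t
  simp only [sum_bernoulliMass_mul_logLikelihood] at hL
  rw [← hL]
  -- Convexity: on [0, 1] the exponential lies below its chord.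
  have hconv : ∀ h, Real.exp (a * Z h) ≤ 1 + Real.exp a * Z h := fun h => by
    have := convexOn_exp.2 (Set.mem_univ 0) (Set.mem_univ a) (sub_nonneg.2 (hZ h).2) (hZ h).1
      (by ring)
    simp only [smul_eq_mul, mul_zero, zero_add, Real.exp_zero, mul_one] at this
    rw [mul_comm a]
    linarith [(hZ h).1]
  -- Jensen's inequality in the form x + 1 ≤ exp x. The shift by log 2 compensates for an
  -- exponential moment that is at most 2, by `h2` and `ha`.
  have h1 : historyExp π ν t (fun h => a * Z h + (-1 * ∑ s, logLikelihood θ θ' (h s) +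
      -(Real.log 2) )) ≤ historyExp π ν t (fun h => (1 / 2) * (Real.exp (a * Z h) *
        Real.exp (-∑ s, logLikelihood θ θ' (h s))) + -1) := by
    refine historyExp_mono fun h => ?_
    have := Real.add_one_le_exp (a * Z h + (-1 * ∑ s, logLikelihood θ θ' (h s) + -(Real.log 2)))
    have e : Real.exp (a * Z h + (-1 * ∑ s, logLikelihood θ θ' (h s) + -(Real.log 2))) =
        (1 / 2) * (Real.exp (a * Z h) * Real.exp (-∑ s, logLikelihood θ θ' (h s))) := by
      rw [Real.exp_add, Real.exp_add, Real.exp_neg (Real.log 2), Real.exp_log two_pos, neg_one_mul]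
      ring
    linarith
  have h2 : historyExp π ν t (fun h => Real.exp (a * Z h) *
      Real.exp (-∑ s, logLikelihood θ θ' (h s))) ≤
        historyExp π ν' t fun h => 1 + Real.exp a * Z h := by
    refine Finset.sum_le_sum fun h _ => ?_
    have := historyLaw_mul_exp_le (π := π) hθ hθ' hν hν' hac t h
    calc _ = ((historyLaw π ν t h).toReal * Real.exp (-∑ s, logLikelihood θ θ' (h s))) *
          Real.exp (a * Z h) := by ring
      _ ≤ _ := mul_le_mul this (hconv h) (Real.exp_nonneg _) ENNReal.toReal_nonneg
  rw [historyExp_add, historyExp_const, historyExp_const_mul] at h2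
  rw [historyExp_add, historyExp_add, historyExp_add, historyExp_const, historyExp_const,
    historyExp_const_mul, historyExp_const_mul, historyExp_const_mul] at h1
  linarith

end ChangeOfMeasure

/-! ### Confusing parameters -/

section Unimodal

variable {K : ℕ} {r θ : Fin K → ℝ} {kstar : Fin K}

theorem strictMonoOn_strictAntiOn_of_isOptimal (hθ : θ ∈ unimodalParams r)
    (hk : IsOptimal r θ kstar) :
    StrictMonoOn (fun k => r k * θ k) (Set.Iic kstar) ∧
      StrictAntiOn (fun k => r k * θ k) (Set.Ici kstar) := by
  obtain ⟨-, m, hm, ha⟩ := hθ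
  have : m = kstar := by
    rcases lt_trichotomy m kstar with h | h | h
    · exact absurd (hk m) (not_le.2 (ha (Set.mem_Ici.2 le_rfl) (Set.mem_Ici.2 h.le) h))
    · exact h
    · exact absurd (hk m) (not_le.2 (hm (Set.mem_Iic.2 h.le) (Set.mem_Iic.2 le_rfl) h))
  exact this ▸ ⟨hm, ha⟩

/-- The parameters obtained from `θ` by raising the success probability at rate `k` to at least
`q`, and hence also those at the lower rates. -/
noncomputable def raise (θ : Fin K → ℝ) (k : Fin K) (q : ℝ) (l : Fin K) : ℝ :=
  if l ≤ k then max (θ l) q else θ l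

theorem raise_mem_correlatedParams (hθ : θ ∈ correlatedParams K) (k : Fin K) {q : ℝ}
    (hq1 : q ≤ 1) : raise θ k q ∈ correlatedParams K := by
  obtain ⟨h01, hanti⟩ := hθ
  refine ⟨fun l => ?_, fun l m hlm => ?_⟩
  · unfold raise
    split_ifs
    · exact ⟨(h01 l).1.trans (le_max_left _ _), max_le (h01 l).2 hq1⟩
    · exact h01 l
  · unfold raise
    split_ifs with h1 h2 h2
    · exact max_le_max (hanti hlm) le_rfl
    · exact absurd (hlm.trans h1) h2
    · exact (hanti hlm).trans (le_max_left _ _)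
    · exact hanti hlm

theorem raise_eq_self_of_lt {k l : Fin K} {q : ℝ} (h : k < l) : raise θ k q l = θ l :=
  if_neg (not_le.2 h)

theorem raise_apply {k : Fin K} {q : ℝ} (hq : θ k ≤ q) : raise θ k q k = q := by
  simp [raise, hq]

theorem mul_raise_lt (hr_pos : ∀ k, 0 < r k) (hr : StrictMono r) (hk : IsOptimal r θ kstar)
    {k l : Fin K} (hlk : l ≠ k) {q : ℝ} (hq0 : 0 < q) (hq : r kstar * θ kstar < r k * q) :
    r l * raise θ k q l < r k * q := by
  unfold raise
  split_ifs with h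
  · rw [mul_max_of_nonneg _ _ (hr_pos l).le]
    exact max_lt ((hk l).trans_lt hq) (mul_lt_mul_of_pos_right (hr (lt_of_le_of_ne h hlk)) hq0)
  · exact (hk l).trans_lt hq

theorem raise_isOptimal (hr_pos : ∀ k, 0 < r k) (hr : StrictMono r) (hk : IsOptimal r θ kstar)
    {k : Fin K} {q : ℝ} (hq0 : 0 < q) (hθq : θ k ≤ q) (hq : r kstar * θ kstar < r k * q) :
    IsOptimal r (raise θ k q) k := fun l => by
  rcases eq_or_ne l k with rfl | hlk
  · exact le_rfl
  · rw [raise_apply hθq]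
    exact (mul_raise_lt hr_pos hr hk hlk hq0 hq).le

/-- Being a neighbour matters here. Rates below k are at most k⋆, where the new throughput is the
maximum of two increasing functions, r θ and r q. Rates above k are at least k⋆, where the
decreasing throughput is unchanged. -/
theorem raise_mem_unimodalParams (hr_pos : ∀ k, 0 < r k) (hr : StrictMono r)
    (hθc : θ ∈ correlatedParams K) (hθ : θ ∈ unimodalParams r) (hk : IsOptimal r θ kstar)
    {k : Fin K} (hkn : (k : ℕ) + 1 = kstar ∨ (k : ℕ) = kstar + 1) {q : ℝ} (hq0 : 0 < q)
    (hq1 : q ≤ 1) (hθq : θ k ≤ q) (hq : r kstar * θ kstar < r k * q) :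
    raise θ k q ∈ unimodalParams r := by
  obtain ⟨hm, ha⟩ := strictMonoOn_strictAntiOn_of_isOptimal hθ hk
  refine ⟨(raise_mem_correlatedParams hθc k hq1).1, k, ?_, ?_⟩
  · intro l _ m hmk hlm
    rcases eq_or_ne m k with rfl | hne
    · simp only [raise_apply hθq]
      exact mul_raise_lt hr_pos hr hk hlm.ne hq0 hq
    · have hmk : m < k := lt_of_le_of_ne hmk hne
      have hms : m ≤ kstar := by rw [Fin.le_def]; rw [Fin.lt_def] at hmk; omega
      simp only [raise, if_pos hmk.le, if_pos (hlm.trans hmk).le,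
        mul_max_of_nonneg _ _ (hr_pos _).le]
      exact max_lt_max (hm (Set.mem_Iic.2 (hlm.le.trans hms)) (Set.mem_Iic.2 hms) hlm)
        (mul_lt_mul_of_pos_right (hr hlm) hq0)
  · intro l hkl m _ hlm
    rcases eq_or_ne l k with rfl | hne
    · simp only [raise_apply hθq]
      exact mul_raise_lt hr_pos hr hk hlm.ne' hq0 hq
    · have hkl : k < l := lt_of_le_of_ne hkl hne.symm
      have hsl : kstar ≤ l := by rw [Fin.le_def]; rw [Fin.lt_def] at hkl; omega
      simp only [raise_eq_self_of_lt hkl, raise_eq_self_of_lt (hkl.trans hlm)]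
      exact ha (Set.mem_Ici.2 hsl) (Set.mem_Ici.2 (hsl.trans hlm.le)) hlm

/-- The rates on the same side of `kstar` as `k`. -/
def sameSide (kstar k : Fin K) : Finset (Fin K) :=
  Finset.univ.filter fun l => if k < kstar then l < kstar else kstar < l

/-- On its side, the neighbour is the rate closest to the peak. -/
theorem gap_le_of_mem_sameSide (hθ : θ ∈ unimodalParams r) (hk : IsOptimal r θ kstar)
    {k l : Fin K} (hkn : (k : ℕ) + 1 = kstar ∨ (k : ℕ) = kstar + 1) (hl : l ∈ sameSide kstar k) :
    r kstar * θ kstar - r k * θ k ≤ r kstar * θ kstar - r l * θ l := by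
  obtain ⟨hm, ha⟩ := strictMonoOn_strictAntiOn_of_isOptimal hθ hk
  simp only [sameSide, Finset.mem_filter, Finset.mem_univ, true_and, Fin.lt_def] at hl
  rw [sub_le_sub_iff_left]
  split_ifs at hl with h
  · exact hm.monotoneOn (Set.mem_Iic.2 (Fin.le_def.2 hl.le)) (Set.mem_Iic.2 (Fin.le_def.2 h.le))
      (Fin.le_def.2 (by omega))
  · exact ha.antitoneOn (Set.mem_Ici.2 (Fin.le_def.2 (by omega)))
      (Set.mem_Ici.2 (Fin.le_def.2 hl.le)) (Fin.le_def.2 (by omega))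

/-- A raised rate l ≤ k has θ_k ≤ θ_l ≤ q, so it is closer to q and harder to tell apart. -/
theorem realKL_raise_le (hθc : θ ∈ correlatedParams K) {k : Fin K} {q : ℝ} (hq1 : q < 1)
    (hθq : θ k < q) (l : Fin K) :
    realKL (θ l) (raise θ k q l) ≤ realKL (θ k) q := by
  have h0 := realKL_pos (hθc.1 k).1 hθq hq1
  unfold raise
  split_ifs with h
  · rcases le_total q (θ l) with h1 | h1
    · rw [max_eq_left h1, realKL_self]
      exact h0.le
    · rw [max_eq_right h1]
      exact realKL_anti_left (hθc.1 k).1 (hθc.2 h) h1 ((hθc.1 k).1.trans_lt hθq) hq1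
  · rw [realKL_self]
    exact h0.le

/-- For k = k⋆ - 1 nothing changes from k⋆ on. For k = k⋆ + 1 the rates up to k⋆ already succeed
with probability at least θ_{k⋆} ≥ q, so only k itself can change. -/
theorem realKL_raise_eq_zero (hθc : θ ∈ correlatedParams K)
    {k l : Fin K} (hkn : (k : ℕ) + 1 = kstar ∨ (k : ℕ) = kstar + 1) {q : ℝ}
    (hqs : kstar < k → q ≤ θ kstar) (hl : l ∉ sameSide kstar k) :
    realKL (θ l) (raise θ k q l) = 0 := by
  simp only [sameSide, Finset.mem_filter, Finset.mem_univ, true_and, Fin.lt_def] at hl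
  rcases lt_or_ge k l with h | h
  · rw [raise_eq_self_of_lt h, realKL_self]
  · rw [Fin.le_def] at h
    split_ifs at hl with h1
    · omega
    · have h2 : q ≤ θ l :=
        (hqs (Fin.lt_def.2 (by omega))).trans (hθc.2 (Fin.le_def.2 (by omega)))
      simp only [raise, max_eq_left h2, ite_self, realKL_self]

theorem bernoulliMass_eq_zero_of_raise {k : Fin K} {q : ℝ} (hq0 : 0 < q) (hq1 : q < 1)
    (l : Fin K) (y : Bool) (h : bernoulliMass (raise θ k q l) y = 0) :
    bernoulliMass (θ l) y = 0 := by
  unfold raise at h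
  split_ifs at h with hlk
  · rcases le_total q (θ l) with h1 | h1
    · rwa [max_eq_left h1] at h
    · rw [max_eq_right h1] at h
      cases y <;> simp [bernoulliMass] at h <;> linarith
  · exact h

end Unimodal

/-! ### Information and regret on one side of the optimum -/

section LowerBound

variable {K : ℕ} {r θ : Fin K → ℝ} {kstar : Fin K} {π : Policy K} {ν : PMF (Fin K → Bool)}

/-- Uniform goodness with α = 1 leaves only o(T) slots to the suboptimal rates. -/
theorem eventually_le_historyExp (hπ : UniformlyGood r π)
    (hθ : θ ∈ correlatedParams K ∩ unimodalParams r) (hν : IsChannel θ ν)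
    (hk : IsOptimal r θ kstar) {δ : ℝ} (hδ : 0 < δ) :
    ∀ᶠ T : ℕ in atTop, 1 - δ ≤ (T : ℝ)⁻¹ * expectedCount π ν kstar T := by
  have h1 : (fun T : ℕ => ∑ l ∈ Finset.univ.erase kstar, expectedCount π ν l T) =o[atTop]
      fun T : ℕ => (T : ℝ) ^ (1 : ℝ) :=
    IsLittleO.fun_sum fun l hl => hπ θ hθ ν hν kstar hk 1 one_pos l (Finset.ne_of_mem_erase hl)
  filter_upwards [h1.bound hδ, eventually_gt_atTop 0] with T hT hT0
  have hT0 : (0 : ℝ) < T := by exact_mod_cast hT0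
  have hs := Finset.add_sum_erase Finset.univ (fun l => expectedCount π ν l T)
    (Finset.mem_univ kstar)
  rw [sum_expectedCount] at hs
  rw [Real.rpow_one, Real.norm_of_nonneg hT0.le] at hT
  have := (le_abs_self _).trans hT
  rw [inv_mul_eq_div, le_div_iff₀ hT0]
  linarith

/-- The information that a uniformly good algorithm gathers against a parameter with another
optimal rate is asymptotically at least `log T`. -/
theorem eventually_log_le_information (hr_pos : ∀ k, 0 < r k) (hr : StrictMono r)
    (hπ : UniformlyGood r π) (hθ : θ ∈ correlatedParams K ∩ unimodalParams r)
    (hν : IsChannel θ ν) (hk : IsOptimal r θ kstar) {k : Fin K}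
    (hkn : (k : ℕ) + 1 = kstar ∨ (k : ℕ) = kstar + 1) {q : ℝ} (hq1 : q < 1) (hθq : θ k < q)
    (hq : r kstar * θ kstar < r k * q) {δ : ℝ} (hδ : 0 < δ) (hδ1 : δ < 1) :
    ∀ᶠ T : ℕ in atTop, (1 - 3 * δ) * Real.log T ≤
      ∑ l, realKL (θ l) (raise θ k q l) * expectedCount π ν l T := by
  have hq0 : 0 < q := (hθ.1.1 k).1.trans_lt hθq
  have hθ' : raise θ k q ∈ correlatedParams K ∩ unimodalParams r :=
    ⟨raise_mem_correlatedParams hθ.1 k hq1.le,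
      raise_mem_unimodalParams hr_pos hr hθ.1 hθ.2 hk hkn hq0 hq1.le hθq.le hq⟩
  obtain ⟨ν', hν'⟩ := exists_isChannel hθ'.1
  have hne : kstar ≠ k := by rintro rfl; omega
  have h1 := (hπ _ hθ' ν' hν' k (raise_isOptimal hr_pos hr hk hq0 hθq.le hq) δ hδ kstar
    hne).bound one_pos
  have hlog : Tendsto (fun T : ℕ => Real.log T) atTop atTop :=
    Real.tendsto_log_atTop.comp tendsto_natCast_atTop_atTop
  filter_upwards [h1, eventually_le_historyExp hπ hθ hν hk hδ, eventually_gt_atTop 0,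
    hlog.eventually_ge_atTop (Real.log 2 / δ)] with T hT hTs hT0 hTl
  have hT0 : (0 : ℝ) < T := by exact_mod_cast hT0
  rw [div_le_iff₀ hδ] at hTl
  rw [one_mul, Real.norm_of_nonneg (expectedCount_nonneg _),
    Real.norm_of_nonneg (Real.rpow_nonneg hT0.le _)] at hT
  have hlogT : 0 ≤ Real.log T :=
    nonneg_of_mul_nonneg_left ((Real.log_nonneg one_le_two).trans hTl) hδ
  -- `Z` is the fraction of slots spent at k⋆. Its mean under the raised parameter is at most
  -- T^(δ-1), which is what exp a = T^(1-δ) can absorb.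
  have key := mul_historyExp_sub_log_two_le (π := π) hθ.1.1 hθ'.1.1 hν hν'
    (bernoulliMass_eq_zero_of_raise hq0 hq1) (t := T)
    (fun h => (T : ℝ)⁻¹ * selectionCount kstar h)
    (fun h => ⟨by positivity, by
      rw [inv_mul_eq_div, div_le_one hT0]
      exact_mod_cast selectionCount_le kstar h⟩) ((1 - δ) * Real.log T) (by
      rw [historyExp_const_mul, ← expectedCount_eq_historyExp, mul_comm (1 - δ),
        ← Real.rpow_def_of_pos hT0, Real.rpow_sub hT0, Real.rpow_one]
      have hp := Real.rpow_pos_of_pos hT0 δ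
      calc _ = expectedCount π ν' kstar T / (T : ℝ) ^ δ := by field_simp
        _ ≤ 1 := (div_le_one hp).2 hT)
  rw [historyExp_const_mul, ← expectedCount_eq_historyExp] at key
  have h2 : (1 - δ) * Real.log T * (1 - δ) ≤
      (1 - δ) * Real.log T * ((T : ℝ)⁻¹ * expectedCount π ν kstar T) :=
    mul_le_mul_of_nonneg_left hTs (mul_nonneg (by linarith) hlogT)
  -- (1 - δ)² log T - log 2 ≥ (1 - 3δ) log T, because log 2 ≤ δ log T.
  have h3 : 0 ≤ Real.log T * δ ^ 2 := by positivity
  nlinarith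

/-- The expected regret incurred at the rates on the same side of `kstar` as `k`. -/
noncomputable def sideRegret (r θ : Fin K → ℝ) (kstar : Fin K) (π : Policy K)
    (ν : PMF (Fin K → Bool)) (k : Fin K) (T : ℕ) : ℝ :=
  ∑ l ∈ sameSide kstar k, (r kstar * θ kstar - r l * θ l) * expectedCount π ν l T

theorem gap_mul_expectedCount_nonneg (hk : IsOptimal r θ kstar) (l : Fin K) (T : ℕ) :
    0 ≤ (r kstar * θ kstar - r l * θ l) * expectedCount π ν l T :=
  mul_nonneg (sub_nonneg.2 (hk l)) (expectedCount_nonneg _)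

theorem gap_mul_information_le (hθ : θ ∈ correlatedParams K ∩ unimodalParams r)
    (hk : IsOptimal r θ kstar) {k : Fin K}
    (hkn : (k : ℕ) + 1 = kstar ∨ (k : ℕ) = kstar + 1) {q : ℝ} (hq1 : q < 1) (hθq : θ k < q)
    (hqs : kstar < k → q ≤ θ kstar) (T : ℕ) :
    (r kstar * θ kstar - r k * θ k) *
        ∑ l, realKL (θ l) (raise θ k q l) * expectedCount π ν l T ≤
      realKL (θ k) q * sideRegret r θ kstar π ν k T := by
  have h0 := realKL_pos (hθ.1.1 k).1 hθq hq1
  rw [sideRegret, ← Finset.sum_subset (Finset.subset_univ (sameSide kstar k)) fun l _ hl => by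
    rw [realKL_raise_eq_zero hθ.1 hkn hqs hl, zero_mul], Finset.mul_sum, Finset.mul_sum]
  refine Finset.sum_le_sum fun l hl => ?_
  have hE := expectedCount_nonneg (π := π) (ν := ν) (t := T) l
  have hg := gap_le_of_mem_sameSide hθ.2 hk hkn hl
  have hg0 := sub_nonneg.2 (hk k)
  calc _ ≤ (r kstar * θ kstar - r k * θ k) * (realKL (θ k) q * expectedCount π ν l T) :=
        mul_le_mul_of_nonneg_left
          (mul_le_mul_of_nonneg_right (realKL_raise_le hθ.1 hq1 hθq l) hE) hg0
    _ ≤ (r kstar * θ kstar - r l * θ l) * (realKL (θ k) q * expectedCount π ν l T) :=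
        mul_le_mul_of_nonneg_right hg (mul_nonneg h0.le hE)
    _ = _ := by ring

/-- At q₀ itself k would only tie with k⋆, so some q > q₀ is fixed before T grows. Half of `ε` pays
for moving from q₀ to q by continuity, half for the factor 1 - 3δ. -/
theorem eventually_div_realKL_le (hr_pos : ∀ k, 0 < r k) (hr : StrictMono r)
    (hπ : UniformlyGood r π) (hθ : θ ∈ correlatedParams K ∩ unimodalParams r)
    (hν : IsChannel θ ν) (hk : IsOptimal r θ kstar) {k : Fin K}
    (hkn : (k : ℕ) + 1 = kstar ∨ (k : ℕ) = kstar + 1) (hq1 : r kstar * θ kstar / r k < 1)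
    (hθq : θ k < r kstar * θ kstar / r k) {ε : ℝ} (hε : 0 < ε) :
    ∀ᶠ T : ℕ in atTop, (r kstar * θ kstar - r k * θ k) /
      realKL (θ k) (r kstar * θ kstar / r k) - ε ≤ sideRegret r θ kstar π ν k T / Real.log T := by
  set q₀ := r kstar * θ kstar / r k with hq₀
  set D := r kstar * θ kstar - r k * θ k
  have hD : 0 ≤ D := sub_nonneg.2 (hk k)
  have hq0 : 0 < q₀ := (hθ.1.1 k).1.trans_lt hθq
  have hcont : ContinuousAt (fun q => D / realKL (θ k) q) q₀ :=
    continuousAt_const.div (continuousAt_realKL hq0 hq1)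
      (realKL_pos (hθ.1.1 k).1 hθq hq1).ne'
  -- For the upper neighbour r_{k⋆} < r_k, which leaves room for q between q₀ and θ_{k⋆}.
  have hqs : kstar < k → q₀ < θ kstar := fun h => by
    have hs : 0 < θ kstar := pos_of_mul_pos_right
      ((div_pos_iff_of_pos_right (hr_pos k)).1 hq0) (hr_pos kstar).le
    rw [hq₀, div_lt_iff₀ (hr_pos k), mul_comm]
    exact mul_lt_mul_of_pos_left (hr h) hs
  have e1 : ∀ᶠ q in nhdsWithin q₀ (Set.Ioi q₀), D / realKL (θ k) q₀ - ε / 2 < D / realKL (θ k) q :=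
    (hcont.eventually_const_lt (sub_lt_self _ (half_pos hε))).filter_mono nhdsWithin_le_nhds
  have e2 : ∀ᶠ q in nhdsWithin q₀ (Set.Ioi q₀), q < 1 :=
    (eventually_lt_nhds hq1).filter_mono nhdsWithin_le_nhds
  have e3 : ∀ᶠ q in nhdsWithin q₀ (Set.Ioi q₀), kstar < k → q ≤ θ kstar := by
    by_cases h : kstar < k
    · exact ((eventually_lt_nhds (hqs h)).filter_mono nhdsWithin_le_nhds).mono
        fun q hq _ => hq.le
    · exact Eventually.of_forall fun q hq => absurd hq h
  obtain ⟨q, hqD, hq1', hqs', hqq⟩ :=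
    (e1.and (e2.and (e3.and self_mem_nhdsWithin))).exists
  have hqq : q₀ < q := hqq
  have hθq' := hθq.trans hqq
  have hI := realKL_pos (hθ.1.1 k).1 hθq' hq1'
  have hqr : r kstar * θ kstar < r k * q := by
    rw [hq₀, div_lt_iff₀ (hr_pos k)] at hqq
    linarith
  set c := D / realKL (θ k) q
  have hc : 0 ≤ c := div_nonneg hD hI.le
  obtain ⟨δ, hδ, hδ1, hδc⟩ : ∃ δ : ℝ, 0 < δ ∧ δ < 1 ∧ c * (3 * δ) ≤ ε / 2 := by
    -- `c + 1` replaces `c` to keep the denominator positive.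
    refine ⟨min (1 / 2) (ε / (6 * (c + 1))), by positivity,
      (min_le_left _ _).trans_lt (by norm_num), ?_⟩
    calc c * (3 * min (1 / 2) (ε / (6 * (c + 1)))) ≤ (c + 1) * (3 * (ε / (6 * (c + 1)))) := by
          gcongr
          · linarith
          · exact min_le_right _ _
      _ = ε / 2 := by field_simp; norm_num
  filter_upwards [eventually_log_le_information hr_pos hr hπ hθ hν hk hkn hq1' hθq' hqr hδ hδ1,
    eventually_gt_atTop 1] with T hT hT1
  have hlog : 0 < Real.log T := Real.log_pos (by exact_mod_cast hT1)
  have h1 := gap_mul_information_le (π := π) (ν := ν) hθ hk hkn hq1' hθq' hqs' T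
  have h2 : c * ((1 - 3 * δ) * Real.log T) ≤ sideRegret r θ kstar π ν k T := by
    rw [div_mul_eq_mul_div, div_le_iff₀ hI, mul_comm (sideRegret _ _ _ _ _ _ _)]
    exact (mul_le_mul_of_nonneg_left hT hD).trans h1
  calc D / realKL (θ k) q₀ - ε ≤ c * (1 - 3 * δ) := by linarith
    _ ≤ _ := by
      rw [le_div_iff₀ hlog]
      linarith

/-! ### Summation over the neighbours -/

theorem mem_neighbours {k : Fin K} : k ∈ neighbours r θ kstar ↔
    ((k : ℕ) + 1 = kstar ∨ (k : ℕ) = kstar + 1) ∧ r kstar * θ kstar ≤ r k := by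
  simp [neighbours]

theorem card_neighbours_le_two : (neighbours r θ kstar).card ≤ 2 := by
  refine (Finset.card_le_card_of_injOn (t := {(kstar : ℕ) - 1, (kstar : ℕ) + 1}) Fin.val
    (fun l hl => ?_) Fin.val_injective.injOn).trans Finset.card_le_two
  have := (mem_neighbours.1 hl).1
  simp only [Finset.coe_insert, Finset.coe_singleton, Set.mem_insert_iff, Set.mem_singleton_iff]
  omega

/-- The summand of `lowerConst` belonging to the rate `k`. -/
noncomputable def lowerTerm (r θ : Fin K → ℝ) (kstar k : Fin K) : ℝ≥0∞ :=
  ENNReal.ofReal (r kstar * θ kstar - r k * θ k) / bernoulliKL (θ k) (r kstar * θ kstar / r k)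

theorem lowerTerm_of_mem_neighbours (hr_pos : ∀ k, 0 < r k)
    (hθ : θ ∈ correlatedParams K ∩ unimodalParams r) (hk : IsOptimal r θ kstar) {k : Fin K}
    (hkn : k ∈ neighbours r θ kstar) :
    lowerTerm r θ kstar k = 0 ∨
      (r kstar * θ kstar / r k < 1 ∧ θ k < r kstar * θ kstar / r k ∧
        lowerTerm r θ kstar k = ENNReal.ofReal ((r kstar * θ kstar - r k * θ k) /
          realKL (θ k) (r kstar * θ kstar / r k))) := by
  obtain ⟨hkn, hle⟩ := mem_neighbours.1 hkn
  obtain ⟨hm, ha⟩ := strictMonoOn_strictAntiOn_of_isOptimal hθ.2 hk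
  have hlt : r k * θ k < r kstar * θ kstar := by
    rcases hkn with h | h
    · have h : k < kstar := Fin.lt_def.2 (by omega)
      exact hm (Set.mem_Iic.2 h.le) (Set.mem_Iic.2 le_rfl) h
    · have h : kstar < k := Fin.lt_def.2 (by omega)
      exact ha (Set.mem_Ici.2 le_rfl) (Set.mem_Ici.2 h.le) h
  have hθq : θ k < r kstar * θ kstar / r k := by
    rw [lt_div_iff₀ (hr_pos k)]
    linarith
  have hq0 := (hθ.1.1 k).1.trans_lt hθq
  unfold lowerTerm
  -- In the boundary case r_k = r_{k⋆} θ_{k⋆} the target probability is 1 > θ_k; the divergence is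
  -- infinite and the summand is 0.
  rcases ((div_le_one (hr_pos k)).2 hle).eq_or_lt with h1 | h1
  · left
    rw [h1] at hθq ⊢
    rw [bernoulliKL, if_pos (Or.inr ⟨rfl, hθq.ne⟩), ENNReal.div_top]
  · right
    refine ⟨h1, hθq, ?_⟩
    rw [bernoulliKL, if_neg (by rintro (h | h) <;> linarith [h.1]),
      ENNReal.ofReal_div_of_pos (realKL_pos (hθ.1.1 k).1 hθq h1), realKL]

theorem eventually_lowerTerm_le (hr_pos : ∀ k, 0 < r k) (hr : StrictMono r)
    (hπ : UniformlyGood r π) (hθ : θ ∈ correlatedParams K ∩ unimodalParams r)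
    (hν : IsChannel θ ν) (hk : IsOptimal r θ kstar) {k : Fin K}
    (hkn : k ∈ neighbours r θ kstar) {ε : ℝ} (hε : 0 < ε) :
    ∀ᶠ T : ℕ in atTop,
      (lowerTerm r θ kstar k).toReal - ε ≤ sideRegret r θ kstar π ν k T / Real.log T := by
  rcases lowerTerm_of_mem_neighbours hr_pos hθ hk hkn with h | ⟨h1, h2, h⟩
  · refine Eventually.of_forall fun T => ?_
    have : 0 ≤ sideRegret r θ kstar π ν k T / Real.log T :=
      div_nonneg (Finset.sum_nonneg fun l _ => gap_mul_expectedCount_nonneg hk l T)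
        (Real.log_natCast_nonneg T)
    rw [h, ENNReal.toReal_zero]
    linarith
  · rw [h, ENNReal.toReal_ofReal (div_nonneg (sub_nonneg.2 (hk k))
      (realKL_pos (hθ.1.1 k).1 h2 h1).le)]
    exact eventually_div_realKL_le hr_pos hr hπ hθ hν hk (mem_neighbours.1 hkn).1 h1 h2 hε

theorem regret_eq_sum (T : ℕ) : regret r θ kstar π ν T =
    ∑ l, (r kstar * θ kstar - r l * θ l) * expectedCount π ν l T := by
  simp only [sub_mul, Finset.sum_sub_distrib, ← Finset.mul_sum, sum_expectedCount, regret]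
  congr 1
  · ring
  · exact Finset.sum_congr rfl fun l _ => by ring

/-- Distinct neighbours lie on opposite sides of k⋆, so no selection is charged twice. -/
theorem sum_sideRegret_le_regret (hk : IsOptimal r θ kstar) (T : ℕ) :
    ∑ k ∈ neighbours r θ kstar, sideRegret r θ kstar π ν k T ≤ regret r θ kstar π ν T := by
  unfold sideRegret
  rw [← Finset.sum_biUnion, regret_eq_sum]
  · exact Finset.sum_le_univ_sum_of_nonneg fun l => gap_mul_expectedCount_nonneg hk l T
  · intro k hk k' hk' hne
    have h1 := (mem_neighbours.1 hk).1
    have h2 := (mem_neighbours.1 hk').1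
    refine Finset.disjoint_left.2 fun l hl hl' => hne (Fin.ext ?_)
    simp only [sameSide, Finset.mem_filter, Finset.mem_univ, true_and, Fin.lt_def] at hl hl'
    split_ifs at hl hl' <;> omega

theorem lowerTerm_ne_top (hr_pos : ∀ k, 0 < r k)
    (hθ : θ ∈ correlatedParams K ∩ unimodalParams r) (hk : IsOptimal r θ kstar) {k : Fin K}
    (hkn : k ∈ neighbours r θ kstar) : lowerTerm r θ kstar k ≠ ⊤ := by
  rcases lowerTerm_of_mem_neighbours hr_pos hθ hk hkn with h | ⟨-, -, h⟩ <;> simp [h]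

theorem eventually_lowerConst_le (hr_pos : ∀ k, 0 < r k) (hr : StrictMono r)
    (hπ : UniformlyGood r π) (hθ : θ ∈ correlatedParams K ∩ unimodalParams r)
    (hν : IsChannel θ ν) (hk : IsOptimal r θ kstar) {ε : ℝ} (hε : 0 < ε) :
    ∀ᶠ T : ℕ in atTop, (∑ k ∈ neighbours r θ kstar, (lowerTerm r θ kstar k).toReal) - ε ≤
      regret r θ kstar π ν T / Real.log T := by
  -- At most two neighbours, each allowed an error ε / 2.
  have h := (neighbours r θ kstar).eventually_all.2 fun k hkn =>
    eventually_lowerTerm_le hr_pos hr hπ hθ hν hk hkn (half_pos hε)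
  filter_upwards [h] with T hT
  have hc : ((neighbours r θ kstar).card : ℝ) ≤ 2 := by exact_mod_cast card_neighbours_le_two
  have h1 := Finset.sum_le_sum hT
  rw [Finset.sum_sub_distrib, Finset.sum_const, nsmul_eq_mul, ← Finset.sum_div] at h1
  have h2 := div_le_div_of_nonneg_right (sum_sideRegret_le_regret (π := π) (ν := ν) hk T)
    (Real.log_natCast_nonneg T)
  have h3 := mul_le_mul_of_nonneg_right hc (half_pos hε).le
  linarith

end LowerBound

end RateSelection

theorem mainTheorem1 {K : ℕ} (r : Fin K → ℝ) (hr_pos : ∀ k, 0 < r k) (hr : StrictMono r)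
    (π : RateSelection.Policy K) (hπ : RateSelection.UniformlyGood r π)
    (θ : Fin K → ℝ)
    (hθ : θ ∈ RateSelection.correlatedParams K ∩ RateSelection.unimodalParams r)
    (ν : PMF (Fin K → Bool)) (hν : RateSelection.IsChannel θ ν)
    (kstar : Fin K) (hk : RateSelection.IsOptimal r θ kstar) :
    (RateSelection.neighbours r θ kstar).card ≤ 2 ∧
      ((RateSelection.lowerConst r θ kstar : ENNReal) : EReal) ≤
        Filter.liminf
          (fun T : ℕ =>
            ((RateSelection.regret r θ kstar π ν T / Real.log (T : ℝ) : ℝ) : EReal))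
          Filter.atTop := by
  refine ⟨RateSelection.card_neighbours_le_two, ?_⟩
  have hC : ((RateSelection.lowerConst r θ kstar : ENNReal) : EReal) =
      ((∑ k ∈ RateSelection.neighbours r θ kstar,
        (RateSelection.lowerTerm r θ kstar k).toReal : ℝ) : EReal) := by
    have hne := fun k hkn => RateSelection.lowerTerm_ne_top hr_pos hθ hk (k := k) hkn
    rw [← ENNReal.toReal_sum hne, EReal.coe_ennreal_toReal (ENNReal.sum_ne_top.2 hne)]
    rfl
  rw [hC]
  -- It suffices to reach every real `c` below the constant; the deficit serves as ε.
  refine EReal.ge_of_forall_gt_iff_ge.1 fun c hc => ?_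
  rw [EReal.coe_lt_coe_iff] at hc
  refine le_liminf_of_le (by isBoundedDefault) ?_
  filter_upwards [RateSelection.eventually_lowerConst_le hr_pos hr hπ hθ hν hk
    (sub_pos.2 hc)] with T hT
  rw [EReal.coe_le_coe_iff]
  linarith
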